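/- Let $A$ be an $m\times n$ integer matrix with $n\ge 3$ columns, and write $[N]=\{1,\dots,N\}$. The equation $A\mathbf{x}=\mathbf{0}$ is called *graph-regular* if there is a function $N_A:\mathbb{N}\to\mathbb{N}$ such that for every number of colours $r$ and every $N>N_A(r)$, every $r$-colouring of the edges of the complete graph on $[N]$ has a solution $\mathbf{x}=(x(1),\dots,x(n))\in[N]^n$ of $A\mathbf{x}=\mathbf{0}$ with pairwise distinct entries such that all edges $\{x(i),x(j)\}$, $i\ne j$, have the same colour. The matrix $A$ satisfies the *weak graph columns condition* if there are $T\ge 0$, vectors $\mathbf{z}_0,\dots,\mathbf{z}_T\in\mathbb{Q}^n$ in the nullspace of $A$, and graphs $R_0\supseteq\dots\supseteq R_T$ on the common vertex set $[n]$ such that for all $0\le t\le T$ and all $i\neq j$ in $[n]$: 1. if $\{i,j\}\in R_t$, then $z_s(i)=z_s(j)$ for all $s\le t$; 2. if $\{i,j\}\notin R_t$, then there is an $s\le t$ with $|z_s(j)-z_s(i)|=1$; 3. $R_T$ has no edges; 4. $\mathbf{z}_0=\mathbf{1}$ (the all-ones vector). The matrix $A$ satisfies the *strong graph columns condition* if the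 same holds with (1) and (2) replaced by - (1*) if $\{i,j\}\in R_t$, then $z_s(i)=z_s(j)\in\{0,1\}$ for all $s\le t$; - (2*) if $\{i,j\}\notin R_t$, then there is an $s\le t$ with $\{z_s(i),z_s(j)\}=\{0,1\}$. **Theorem.** If $A\mathbf{x}=\mathbf{0}$ is graph-regular, then $A$ satisfies the weak graph columns condition. Conversely, if $A$ satisfies the strong graph columns condition, then $A\mathbf{x}=\mathbf{0}$ is graph-regular. -/

import Mathlib

namespace GraphRado

/-- `A x = 0` is graph-regular: there is a function `N_A` such that for every number `r` of colours
and every `N > N_A r`, each `r`-colouring of the edges of the complete graph on `[N] = {1, …, N}`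
admits a solution `x` with pairwise distinct entries in `[N]`, all of whose edges
`{x i, x j}` have the same colour. -/
def GraphRegular {m n : ℕ} (A : Matrix (Fin m) (Fin n) ℤ) : Prop :=
  ∃ NA : ℕ → ℕ, ∀ r N : ℕ, NA r < N →
    ∀ χ : SimpleGraph.TopEdgeLabeling (Finset.Icc 1 N) (Fin r),
      ∃ x : Fin n → Finset.Icc 1 N,
        Function.Injective x ∧
        A.mulVec (fun i => ((x i : ℕ) : ℤ)) = 0 ∧
        ∃ c : Fin r, ∀ (i j : Fin n)
          (h : (⊤ : SimpleGraph (Finset.Icc 1 N)).Adj (x i) (x j)), χ.get (x i) (x j) h = c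

/-- Data common to the weak and the strong graph columns condition: rational vectors
`z 0, …, z T` in the nullspace of `A` with `z 0 = 1`, and a decreasing sequence of graphs
`R 0 ⊇ ⋯ ⊇ R T` on the vertex set `[n]` with `R T` empty. -/
def GraphSequence {m n : ℕ} (A : Matrix (Fin m) (Fin n) ℤ) (T : ℕ)
    (z : Fin (T + 1) → Fin n → ℚ) (R : Fin (T + 1) → SimpleGraph (Fin n)) : Prop :=
  (∀ t, (A.map (Int.cast : ℤ → ℚ)).mulVec (z t) = 0) ∧
  Antitone R ∧
  R (Fin.last T) = ⊥ ∧
  z 0 = fun _ => 1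

/-- The weak graph columns condition. Pairs that are still restricted at time `t` have had
equal values up to and including time `t`; pairs that are not have differed by exactly `1`
at some time up to `t`. -/
def WeakGraphColumnsCondition {m n : ℕ} (A : Matrix (Fin m) (Fin n) ℤ) : Prop :=
  ∃ (T : ℕ) (z : Fin (T + 1) → Fin n → ℚ) (R : Fin (T + 1) → SimpleGraph (Fin n)),
    GraphSequence A T z R ∧
    (∀ t i j, (R t).Adj i j → ∀ s ≤ t, z s i = z s j) ∧
    (∀ t i j, i ≠ j → ¬ (R t).Adj i j → ∃ s ≤ t, |z s j - z s i| = 1)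

/-- The strong graph columns condition: restricted pairs have had a common value in `{0, 1}`
at each time up to and including `t`, and pairs that are not restricted have had the two values
`0` and `1`, in some order, at some time up to `t`. -/
def StrongGraphColumnsCondition {m n : ℕ} (A : Matrix (Fin m) (Fin n) ℤ) : Prop :=
  ∃ (T : ℕ) (z : Fin (T + 1) → Fin n → ℚ) (R : Fin (T + 1) → SimpleGraph (Fin n)),
    GraphSequence A T z R ∧
    (∀ t i j, (R t).Adj i j → ∀ s ≤ t, z s i = z s j ∧ (z s i = 0 ∨ z s i = 1)) ∧
    (∀ t i j, i ≠ j → ¬ (R t).Adj i j →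
      ∃ s ≤ t, (z s i = 0 ∧ z s j = 1) ∨ (z s i = 1 ∧ z s j = 0))

end GraphRado

/-!
Sufficiency. Under the strong condition, put `x = y₀ z₀ + ∑ y_s z_{s+1}`, which solves `A x = 0`
for all rational `y₀, y_s`. Consider two entries `x i`, `x j` and the time at which the pair
`{i, j}` stops being restricted. Before that time the coefficients of `x i` and `x j` are equal and
are `0` or `1`, at that time they are `1` and `0`, and afterwards they are arbitrary elements of a
fixed finite set: the two coefficient words *split* at that time (`SplitAt`). So it is enough to
find generators such that all pairs of words that split have values joined by an edge of the same
colour. Generators for which the colour depends only on the place of splitting are constructed in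
`exists_split_colours`, by induction on their number, from Gallai's theorem in a high-dimensional
space and the pigeonhole principle; the pigeonhole principle then gives one colour
(`exists_split_monochromatic`). All this takes place in a finite set of rationals that depends only
on the number of colours. An affine map with integer coefficients takes this set into `[1, N]`
(`exists_affine_into_Icc`); it takes solutions to solutions because `z₀ = 1` is in the nullspace.

Necessity. For a large prime `p`, colour an edge `{a, a'}` with `a < a'` by the last nonzero base
`p` digits of `a' - a`, `a` and `a'`, and by whether `a` and `a'` have the same `p`-adic valuation.
As `n ≥ 3`, the entries of a monochromatic solution `x` all have the same last digit, and their
valuations are all equal or pairwise distinct; either way the columns of `A` sum to zero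
(`mulVec_one_eq_zero`), so `z₀ = 1` is admissible. Let `R_t` be congruence of entries modulo
`p ^ t`. All differences have the same last nonzero digit `d`, so modulo `p ^ (t + 1)` an entry is
congruent to the least entry in its class modulo `p ^ t` or exceeds it by `d p ^ t`. Hence `x` is,
modulo `p ^ (t + 1)`, a vector constant on classes plus `d p ^ t w` with `w` a `0`-`1` vector.
Rado's lemma (`exists_prime_bound`) turns this congruence into a rational vector in the nullspace
whose differences within classes are those of `w`, and this is `z_{t+1}`.
-/

namespace GraphRado

/-! ### Finite sets forcing a split structure of one colour -/

/-- Finitary form of Gallai's theorem: the dilation factor and the translation of a monochromatic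
homothetic copy of `S` can be taken from a finite set that depends only on `S` and on the set of
colours, not on the colouring. -/
theorem exists_finite_homothety {M : Type*} [AddCommMonoid M] (S : Finset M) (κ : Type*)
    [Finite κ] :
    ∃ P : Set (ℕ × M), P.Finite ∧ ∀ C : M → κ, ∃ p ∈ P, 0 < p.1 ∧
      ∃ c, ∀ s ∈ S, C (p.1 • s + p.2) = c := by
  classical
  obtain ⟨ι, _, hι⟩ := Combinatorics.Line.exists_mono_in_high_dimension S κ
  let F : (ι → Option S) → ℕ × M := fun f =>
    (({i | f i = none} : Finset ι).card, ∑ i ∈ ({i | f i ≠ none} : Finset ι),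
      ((f i).map (fun s : S => (s : M))).getD 0)
  refine ⟨Set.range F, Set.finite_range F, fun C => ?_⟩
  obtain ⟨l, c, hl⟩ := hι fun v => C (∑ i, (v i : M))
  refine ⟨F l.idxFun, ⟨_, rfl⟩, ?_, c, ?_⟩
  · obtain ⟨i, hi⟩ := l.proper
    exact Finset.card_pos.mpr ⟨i, by simpa using hi⟩
  · intro s hs
    rw [← hl ⟨s, hs⟩]
    congr 1
    rw [← Finset.sum_filter_add_sum_filter_not Finset.univ (fun i => l.idxFun i = none)]
    congr 1
    · rw [← Finset.sum_const]
      refine Finset.sum_congr rfl fun i hi => ?_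
      rw [l.apply_none _ _ (by simpa using hi)]
    · refine Finset.sum_congr rfl fun i hi => ?_
      obtain ⟨a, ha⟩ := Option.ne_none_iff_exists.mp (by simpa using hi : l.idxFun i ≠ none)
      simp [← ha]

/-- The words `w` and `w'` agree before position `t`, with letters `0` and `1` only, and at
position `t` they have the letters `1` and `0`; nothing is required after `t`. -/
def SplitAt {T : ℕ} (t : Fin T) (w w' : Fin T → ℚ) : Prop :=
  (∀ s < t, w s = w' s ∧ (w s = 0 ∨ w s = 1)) ∧ w t = 1 ∧ w' t = 0

/-- For every colouring of pairs of rationals there are generators `y₀; y 0, …, y (T - 1)` such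
that the colour of a pair of values of words splitting at `t` depends only on `t`. The values lie
in a finite set `V` that does not depend on the colouring.

In the induction, Gallai's theorem in `ℚ ^ A` gives `A` translates `p k + d • V'` such that the
colour of a pair of points from the distinct translates `k` and `j` depends only on `k` and `j`.
There are more translates than colourings of `V' × V'`, so two of them are coloured alike. Their
difference is the first generator, and the induction hypothesis applied inside `V'` gives the
other ones. -/
theorem exists_split_colours {Λ : Set ℚ} (hΛ : Λ.Finite) (κ : Type) [Finite κ] (T : ℕ) :
    ∃ V : Set ℚ, V.Finite ∧ ∀ χ : ℚ → ℚ → κ, ∃ (y₀ : ℚ) (y : Fin T → ℚ) (col : Fin T → κ),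
      (∀ w : Fin T → ℚ, (∀ s, w s ∈ Λ) → y₀ + ∑ s, w s * y s ∈ V) ∧
      ∀ (t : Fin T) (w w' : Fin T → ℚ), (∀ s, w s ∈ Λ) → (∀ s, w' s ∈ Λ) → SplitAt t w w' →
        y₀ + ∑ s, w s * y s ≠ y₀ + ∑ s, w' s * y s ∧
        χ (y₀ + ∑ s, w s * y s) (y₀ + ∑ s, w' s * y s) = col t := by
  classical
  induction T with
  | zero =>
    exact ⟨{0}, Set.finite_singleton 0, fun χ => ⟨0, Fin.elim0, Fin.elim0, by simp,
      fun t => t.elim0⟩⟩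
  | succ T ih =>
    obtain ⟨V', hV', ih⟩ := ih
    -- The points `0` and `1` make the copies non-degenerate, so that points from different
    -- translates are distinct.
    let W : Finset ℚ := hV'.toFinset ∪ {0, 1}
    have hW : ∀ v ∈ V', v ∈ W := fun v hv => by simp [W, hv]
    let J := Fin (Nat.card (W → W → κ) + 1)
    obtain ⟨P, hP, hgal⟩ := exists_finite_homothety (M := J → ℚ)
      (Fintype.piFinset fun _ => W) (J → J → κ × Prop)
    refine ⟨(fun q : (ℕ × (J → ℚ)) × (J × J) × ℚ × ℚ => q.1.2 q.2.1.2
        + q.2.2.1 * (q.1.2 q.2.1.1 - q.1.2 q.2.1.2) + q.1.1 * q.2.2.2) ''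
        (P ×ˢ Set.univ ×ˢ Λ ×ˢ V'),
      (hP.prod (Set.finite_univ.prod (hΛ.prod hV'))).image _, fun χ => ?_⟩
    obtain ⟨⟨d, p⟩, hp, hd, c, hc⟩ :=
      hgal fun p k j => (χ (p k) (p j), p k = p j)
    have hd : (d : ℚ) ≠ 0 := by exact_mod_cast hd.ne'
    -- Two translates with the same colour pattern.
    obtain ⟨k, j, hkj, hpat⟩ : ∃ k j : J, k ≠ j ∧
        ∀ a ∈ W, ∀ b ∈ W, χ (d * a + p k) (d * b + p k) = χ (d * a + p j) (d * b + p j) := by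
      have : Fintype (W → W → κ) := Fintype.ofFinite _
      obtain ⟨k, j, hkj, h⟩ := Fintype.exists_ne_map_eq_of_card_lt
        (fun (k : J) (a b : W) => χ (d * a + p k) (d * b + p k))
        (by simp [J, Nat.card_eq_fintype_card])
      exact ⟨k, j, hkj, fun a ha b hb => congrFun (congrFun h ⟨a, ha⟩) ⟨b, hb⟩⟩
    have hcross : ∀ a ∈ W, ∀ b ∈ W,
        (χ (d * a + p k) (d * b + p j), (d * a + p k = d * b + p j)) = c k j := by
      intro a ha b hb
      have h := hc (fun l => if l = k then a else b) (by
        simp only [Fintype.mem_piFinset]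
        intro l
        split_ifs <;> assumption)
      have h := congrFun (congrFun h k) j
      simpa [hkj.symm] using h
    have hne : ∀ a ∈ W, ∀ b ∈ W, d * a + p k ≠ d * b + p j := by
      intro a ha b hb h
      have h0 := congrArg Prod.snd ((hcross a ha b hb).trans
        (hcross 0 (by simp [W]) 0 (by simp [W])).symm)
      have h1 := congrArg Prod.snd ((hcross a ha b hb).trans
        (hcross 1 (by simp [W]) 0 (by simp [W])).symm)
      simp only [h, eq_iff_iff, true_iff] at h0 h1
      apply hd
      linarith
    obtain ⟨y₀, y, col, hmem, hcol⟩ := ih fun a b => χ (d * a + p j) (d * b + p j)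
    have hval : ∀ w : Fin (T + 1) → ℚ,
        d * y₀ + p j + ∑ s, w s * (Fin.cons (p k - p j) (fun s => d * y s) : Fin (T + 1) → ℚ) s
          = d * (y₀ + ∑ s : Fin T, w s.succ * y s) + p j + w 0 * (p k - p j) := by
      intro w
      rw [Fin.sum_univ_succ]
      simp only [Fin.cons_zero, Fin.cons_succ, mul_add, Finset.mul_sum]
      have : ∀ s : Fin T, w s.succ * (d * y s) = d * (w s.succ * y s) := fun s => by ring
      simp only [this]
      ring
    refine ⟨d * y₀ + p j, Fin.cons (p k - p j) fun s => d * y s, Fin.cons (c k j).1 col,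
      fun w hw => ?_, fun t w w' hw hw' hsplit => ?_⟩
    · refine ⟨((d, p), (k, j), w 0, y₀ + ∑ s : Fin T, w s.succ * y s),
        ⟨hp, trivial, hw 0, hmem _ fun s => hw _⟩, ?_⟩
      rw [hval]
      ring
    · rw [hval, hval]
      have hu := hW _ (hmem (fun s => w s.succ) fun s => hw _)
      have hu' := hW _ (hmem (fun s => w' s.succ) fun s => hw' _)
      obtain ⟨hpre, h1, h0⟩ := hsplit
      cases t using Fin.cases with
      | zero =>
        rw [h1, h0]
        have hx := hne _ hu _ hu'
        have hy := congrArg Prod.fst (hcross _ hu _ hu')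
        simpa [add_assoc] using And.intro hx hy
      | succ t =>
        obtain ⟨hne', hcol'⟩ := hcol t (fun s => w s.succ) (fun s => w' s.succ)
          (fun s => hw _) (fun s => hw' _)
          ⟨fun s hs => hpre s.succ (Fin.succ_lt_succ_iff.mpr hs), h1, h0⟩
        obtain ⟨heq, hw0⟩ := hpre 0 (Fin.succ_pos t)
        rw [← heq]
        refine ⟨fun h => hne' ?_, ?_⟩
        · exact mul_left_cancel₀ hd (by linarith)
        · rw [Fin.cons_succ, ← hcol']
          rcases hw0 with hw0 | hw0
          · simp [hw0]
          · rw [hw0]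
            simpa using hpat _ hu _ hu'

/-- As `exists_split_colours`, with one colour for all positions: restrict the words to the
positions in a large colour class, giving the letter `0` to all others. -/
theorem exists_split_monochromatic {Λ : Set ℚ} (hΛ : Λ.Finite) (κ : Type) [Finite κ] [Nonempty κ]
    (T : ℕ) :
    ∃ V : Set ℚ, V.Finite ∧ ∀ χ : ℚ → ℚ → κ, ∃ (y₀ : ℚ) (y : Fin T → ℚ) (c : κ),
      (∀ w : Fin T → ℚ, (∀ s, w s ∈ Λ) → y₀ + ∑ s, w s * y s ∈ V) ∧
      ∀ (t : Fin T) (w w' : Fin T → ℚ), (∀ s, w s ∈ Λ) → (∀ s, w' s ∈ Λ) → SplitAt t w w' →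
        y₀ + ∑ s, w s * y s ≠ y₀ + ∑ s, w' s * y s ∧
        χ (y₀ + ∑ s, w s * y s) (y₀ + ∑ s, w' s * y s) = c := by
  classical
  have : Fintype κ := Fintype.ofFinite κ
  obtain ⟨V, hV, h⟩ := exists_split_colours (hΛ.insert 0) κ (Fintype.card κ * T)
  refine ⟨V, hV, fun χ => ?_⟩
  obtain ⟨y₀, y, col, hmem, hcol⟩ := h χ
  obtain ⟨c, hc⟩ := Fintype.exists_le_card_fiber_of_mul_le_card (n := T) col (by simp)
  let e := Finset.orderEmbOfCardLe _ hc
  have he : ∀ s, col (e s) = c := fun s => by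
    simpa using Finset.orderEmbOfCardLe_mem _ hc s
  have hsum : ∀ w : Fin T → ℚ,
      ∑ s, w s * y (e s) = ∑ s, Function.extend e w 0 s * y s := by
    intro w
    refine Finset.sum_of_injOn e e.injective.injOn (by simp) ?_ ?_
    · intro s _ hs
      rw [Function.extend_apply' _ _ _ (by simpa using hs)]
      simp
    · intro s _
      rw [e.injective.extend_apply]
  have hext : ∀ w : Fin T → ℚ, (∀ s, w s ∈ Λ) → ∀ s, Function.extend e w 0 s ∈ insert 0 Λ := by
    intro w hw s
    by_cases hs : ∃ a, e a = s
    · obtain ⟨a, rfl⟩ := hs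
      rw [e.injective.extend_apply]
      exact Or.inr (hw a)
    · rw [Function.extend_apply' _ _ _ hs]
      exact Or.inl rfl
  refine ⟨y₀, y ∘ e, c, fun w hw => ?_, fun t w w' hw hw' hsplit => ?_⟩
  · simp only [Function.comp_apply, hsum]
    exact hmem _ (hext w hw)
  · simp only [Function.comp_apply, hsum, ← he t]
    refine hcol (e t) _ _ (hext w hw) (hext w' hw') ⟨fun s hs => ?_, ?_, ?_⟩
    · by_cases hs' : ∃ a, e a = s
      · obtain ⟨a, rfl⟩ := hs'
        simp only [e.injective.extend_apply]
        exact hsplit.1 a (e.lt_iff_lt.mp hs)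
      · simp [Function.extend_apply' _ _ _ hs']
    · rw [e.injective.extend_apply, hsplit.2.1]
    · rw [e.injective.extend_apply, hsplit.2.2]

/-- A finite set of rationals is mapped into `[1, N]`, for some `N`, by an affine map with integer
coefficients and positive slope. -/
theorem exists_affine_into_Icc {V : Set ℚ} (hV : V.Finite) :
    ∃ (D K N : ℕ), 0 < D ∧ ∀ v ∈ V, ∃ a : ℕ, 1 ≤ a ∧ a ≤ N ∧ (a : ℚ) = D * v + K := by
  obtain ⟨b, hb⟩ := IsLocalization.exist_integer_multiples_of_finset
    (nonZeroDivisors ℤ) hV.toFinset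
  have hb0 : (b : ℤ) ≠ 0 := nonZeroDivisors.coe_ne_zero b
  have hint : ∀ v ∈ V, ∃ a : ℤ, (a : ℚ) = (b : ℤ).natAbs * v := by
    intro v hv
    obtain ⟨a, ha⟩ := hb v (by simpa using hv)
    have ha : (a : ℚ) = (b : ℤ) * v := by simpa using ha
    rcases Int.natAbs_eq (b : ℤ) with h | h
    · refine ⟨a, ?_⟩
      rw [ha]
      conv_lhs => rw [h]
      simp
    · refine ⟨-a, ?_⟩
      push_cast
      rw [ha]
      conv_lhs => rw [h]
      simp
  choose! f hf using hint
  obtain ⟨B, hB⟩ := (hV.image fun v => (f v).natAbs).bddAbove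
  refine ⟨(b : ℤ).natAbs, B + 1, 2 * B + 1, Int.natAbs_pos.mpr hb0, fun v hv => ?_⟩
  have h := hB ⟨v, hv, rfl⟩
  simp only at h
  refine ⟨(f v + (B + 1)).toNat, by omega, by omega, ?_⟩
  rw [← hf v hv]
  have : (((f v + (B + 1)).toNat : ℤ) : ℚ) = ((f v + (B + 1) : ℤ) : ℚ) := by
    congr 1
    omega
  push_cast at this
  simpa using this

/-! ### The strong condition is sufficient -/

theorem graphRegular_of_strong {m n : ℕ} (hn : 2 ≤ n) {A : Matrix (Fin m) (Fin n) ℤ}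
    (hA : StrongGraphColumnsCondition A) : GraphRegular A := by
  classical
  obtain ⟨T, z, R, ⟨hz, -, hlast, hz0⟩, hadj, hnadj⟩ := hA
  -- A pair of vertices splits at the time when it stops being restricted.
  have hsplit : ∀ i j, i ≠ j → ∃ t : Fin T,
      SplitAt t (fun s => z s.succ i) (fun s => z s.succ j) ∨
      SplitAt t (fun s => z s.succ j) (fun s => z s.succ i) := by
    intro i j hij
    have hex : ∃ t : Fin (T + 1), ¬ (R t).Adj i j := ⟨Fin.last T, by simp [hlast]⟩
    obtain ⟨t, ht, hmin⟩ := (Set.toFinite {t : Fin (T + 1) | ¬ (R t).Adj i j}).exists_minimal hex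
    obtain ⟨s, hst, hs⟩ := hnadj t i j hij ht
    have hlt : ∀ s < t, z s i = z s j ∧ (z s i = 0 ∨ z s i = 1) := by
      intro s hs
      refine hadj s i j ?_ s le_rfl
      by_contra h
      exact absurd (hmin h hs.le) (not_le.mpr hs)
    obtain rfl : s = t := by
      rcases hst.lt_or_eq with h | h
      · have := (hlt s h).1
        rcases hs with hs | hs <;> simp [hs.1, hs.2] at this
      · exact h
    cases s using Fin.cases with
    | zero => simp [hz0] at hs
    | succ s =>
      refine ⟨s, ?_⟩
      rcases hs with hs | hs
      · refine Or.inr ⟨fun a ha => ?_, hs.2, hs.1⟩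
        have := hlt a.succ (Fin.succ_lt_succ_iff.mpr ha)
        exact ⟨this.1.symm, by simpa only [← this.1] using this.2⟩
      · exact Or.inl ⟨fun a ha => hlt a.succ (Fin.succ_lt_succ_iff.mpr ha), hs⟩
  let Λ : Set ℚ := Set.range fun q : Fin (T + 1) × Fin n => z q.1 q.2
  have hΛ : Λ.Finite := Set.finite_range _
  choose V hV hmono using fun r : ℕ => exists_split_monochromatic hΛ (Option (Fin r)) T
  choose D K N hD ha using fun r : ℕ => exists_affine_into_Icc (hV r)
  refine ⟨N, fun r M hM χ => ?_⟩
  -- The colouring transported to the rationals; the colour `none` stands for a pair that does not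
  -- come from an edge.
  let f : ℚ → ℕ := fun q => ⌊D r * q + K r⌋₊
  have hf : ∀ v ∈ V r, f v ∈ Finset.Icc 1 M ∧ (f v : ℚ) = D r * v + K r := by
    intro v hv
    obtain ⟨a, h1, h2, h3⟩ := ha r v hv
    have : f v = a := by simp only [f, ← h3, Nat.floor_natCast]
    rw [this]
    exact ⟨Finset.mem_Icc.mpr ⟨h1, h2.trans hM.le⟩, h3⟩
  obtain ⟨y₀, y, c, hmem, hcol⟩ := hmono r fun u v =>
    if h : ∃ (hu : f u ∈ Finset.Icc 1 M) (hv : f v ∈ Finset.Icc 1 M), f u ≠ f v then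
      some (χ.get ⟨f u, h.1⟩ ⟨f v, h.2.1⟩ (by simpa using h.2.2)) else none
  let x : Fin n → ℚ := fun i => y₀ + ∑ s : Fin T, z s.succ i * y s
  have hzΛ : ∀ i (s : Fin T), z s.succ i ∈ Λ := fun i s => ⟨(s.succ, i), rfl⟩
  have hx : ∀ i, x i ∈ V r := fun i => hmem _ (hzΛ i)
  have hinj : Function.Injective fun i => f (x i) := by
    intro i j hij
    by_contra hne
    have hxx : x i = x j := by
      have h : (D r : ℚ) * x i + K r = D r * x j + K r := by
        rw [← (hf _ (hx i)).2, ← (hf _ (hx j)).2]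
        exact congrArg Nat.cast hij
      have : (D r : ℚ) ≠ 0 := by exact_mod_cast (hD r).ne'
      exact mul_left_cancel₀ this (by linarith)
    obtain ⟨t, h | h⟩ := hsplit i j hne
    · exact (hcol t _ _ (hzΛ i) (hzΛ j) h).1 hxx
    · exact (hcol t _ _ (hzΛ j) (hzΛ i) h).1 hxx.symm
  have hedge : ∀ i j (h : (⊤ : SimpleGraph (Finset.Icc 1 M)).Adj ⟨f (x i), (hf _ (hx i)).1⟩
      ⟨f (x j), (hf _ (hx j)).1⟩), some (χ.get _ _ h) = c := by
    intro i j h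
    have hij : f (x i) ≠ f (x j) := by simpa using h
    obtain ⟨t, hs | hs⟩ := hsplit i j fun h => hij (by rw [h])
    · rw [← (hcol t _ _ (hzΛ i) (hzΛ j) hs).2, dif_pos]
      exact ⟨(hf _ (hx i)).1, (hf _ (hx j)).1, hij⟩
    · rw [← (hcol t _ _ (hzΛ j) (hzΛ i) hs).2, χ.get_comm _ _ h, dif_pos]
      exact ⟨(hf _ (hx j)).1, (hf _ (hx i)).1, hij.symm⟩
  refine ⟨fun i => ⟨f (x i), (hf _ (hx i)).1⟩, fun i j hij => hinj (by simpa using hij), ?_, ?_⟩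
  · have hsol : (A.map (Int.cast : ℤ → ℚ)).mulVec (fun i => (f (x i) : ℚ)) = 0 := by
      have : (fun i => (f (x i) : ℚ)) = (D r * y₀ + K r) • z 0 +
          ∑ s : Fin T, (D r * y s) • z s.succ := by
        funext i
        simp only [(hf _ (hx i)).2, x, hz0, Pi.add_apply, Pi.smul_apply, Finset.sum_apply,
          smul_eq_mul, mul_add, Finset.mul_sum]
        have : ∀ s : Fin T, (D r : ℚ) * (z s.succ i * y s) = D r * y s * z s.succ i :=
          fun s => by ring
        simp only [this]
        ring
      rw [this, Matrix.mulVec_add, Matrix.mulVec_smul, hz, Matrix.mulVec_sum]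
      simp [Matrix.mulVec_smul, hz]
    funext k
    have := congrFun hsol k
    simp only [Matrix.mulVec, dotProduct, Matrix.map_apply, Pi.zero_apply] at this ⊢
    exact_mod_cast this
  · have hadj01 : (⊤ : SimpleGraph (Finset.Icc 1 M)).Adj
        ⟨f (x ⟨0, by omega⟩), (hf _ (hx _)).1⟩ ⟨f (x ⟨1, by omega⟩), (hf _ (hx _)).1⟩ := by
      simpa using hinj.ne (by simp : (⟨0, _⟩ : Fin n) ≠ ⟨1, _⟩)
    exact ⟨_, fun i j h => Option.some.inj ((hedge i j h).trans (hedge _ _ hadj01).symm)⟩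

/-! ### Lifting congruences to rational solutions -/

/-- Rado's lemma. Suppose that modulo `p ^ (e + 1)` some integer solution of `A x = 0` is the sum
of a vector `v`, constant along the relation `S`, and of `d p ^ e w`, where `p ∤ d`. If `p` is
large in terms of `A`, `S` and `w`, then `w` can be modified by a vector constant along `S` to give
a rational solution `z`.

If there is no such `z`, a functional separates `A w` from the image of the vectors constant along
`S`, and `p` divides the nonzero value at `A w` of a fixed integer multiple of it. -/
theorem exists_prime_bound {m n : ℕ} (A : Matrix (Fin m) (Fin n) ℤ) (S : Fin n → Fin n → Prop)
    (w : Fin n → ℤ) :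
    ∃ B : ℕ, ∀ p : ℕ, p.Prime → B < p → ∀ (e : ℕ) (d : ℤ), ¬ (p : ℤ) ∣ d →
      ∀ x v : Fin n → ℤ, A.mulVec x = 0 → (∀ i j, S i j → v i = v j) →
      (∀ i, (p : ℤ) ^ (e + 1) ∣ x i - v i - d * p ^ e * w i) →
      ∃ z : Fin n → ℚ, (A.map (Int.cast : ℤ → ℚ)).mulVec z = 0 ∧
        ∀ i j, S i j → z i - z j = w i - w j := by
  classical
  let Aq := A.map (Int.cast : ℤ → ℚ)
  let U : Submodule ℚ (Fin n → ℚ) :=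
    { carrier := {u | ∀ i j, S i j → u i = u j}
      add_mem' := fun ha hb i j h => by simp [ha i j h, hb i j h]
      zero_mem' := fun _ _ _ => rfl
      smul_mem' := fun c u hu i j h => by simp [hu i j h] }
  by_cases hmem : Aq.mulVec (fun i => (w i : ℚ)) ∈ U.map Aq.mulVecLin
  · obtain ⟨u, hu, huw⟩ := hmem
    refine ⟨0, fun p _ _ e d _ x v _ _ _ => ⟨(fun i => (w i : ℚ)) - u, ?_, fun i j h => ?_⟩⟩
    · rw [Matrix.mulVec_sub, sub_eq_zero, ← huw]
      rfl
    · simp only [Pi.sub_apply, hu i j h]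
      ring
  · obtain ⟨f, hf, hker⟩ := Submodule.exists_le_ker_of_notMem hmem
    obtain ⟨b, hb⟩ := IsLocalization.exist_integer_multiples_of_finite (nonZeroDivisors ℤ)
      fun k : Fin m => f (Pi.single k 1)
    choose l hl using hb
    have hb0 : ((b : ℤ) : ℚ) ≠ 0 := by exact_mod_cast nonZeroDivisors.coe_ne_zero b
    -- The integer functional `g` represents `b • f`, composed with `A`.
    let g : (Fin n → ℤ) → ℤ := fun u => l ⬝ᵥ A.mulVec u
    have hg : ∀ u : Fin n → ℤ, (g u : ℚ) = (b : ℤ) * f (Aq.mulVec fun i => (u i : ℚ)) := by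
      intro u
      have h := LinearMap.pi_apply_eq_sum_univ f (Aq.mulVec fun i => (u i : ℚ))
      rw [h, Finset.mul_sum]
      simp only [g, dotProduct, Int.cast_sum, Int.cast_mul]
      refine Finset.sum_congr rfl fun k _ => ?_
      have hk : (l k : ℚ) = (b : ℤ) * f (Pi.single k 1) := by simpa using hl k
      have hA : ((A.mulVec u k : ℤ) : ℚ) = Aq.mulVec (fun i => (u i : ℚ)) k := by
        simp [Matrix.mulVec, dotProduct, Aq]
      have hs : (fun j => if k = j then (1 : ℚ) else 0) = Pi.single k 1 := by
        funext j
        simp [Pi.single_apply, eq_comm]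
      rw [hk, hA, smul_eq_mul, hs]
      ring
    have hgw : g w ≠ 0 := by
      intro h
      have := hg w
      rw [h, Int.cast_zero, eq_comm, mul_eq_zero] at this
      exact this.elim hb0 hf
    refine ⟨(g w).natAbs, fun p hp hB e d hd x v hx hv hdvd => ?_⟩
    exfalso
    have hgv : g v = 0 := by
      have : f (Aq.mulVec fun i => (v i : ℚ)) = 0 :=
        hker ⟨fun i => (v i : ℚ), fun i j h => by simp [hv i j h], rfl⟩
      have h := hg v
      rw [this, mul_zero] at h
      exact_mod_cast h
    choose q hq using hdvd
    have hgx : g x = 0 := by simp [g, hx]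
    have hxe : x = v + (d * p ^ e) • w + ((p : ℤ) ^ (e + 1)) • q := by
      funext i
      have := hq i
      simp only [Pi.add_apply, Pi.smul_apply, smul_eq_mul]
      linarith
    have hlin : g x = g v + d * p ^ e * g w + (p : ℤ) ^ (e + 1) * g q := by
      rw [hxe]
      simp only [g, Matrix.mulVec_add, Matrix.mulVec_smul, dotProduct_add, dotProduct_smul,
        smul_eq_mul]
    rw [hgx, hgv] at hlin
    have hpe : (p : ℤ) ^ e ≠ 0 := pow_ne_zero _ (by exact_mod_cast hp.ne_zero)
    have hdg : (p : ℤ) ∣ d * g w := by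
      refine ⟨-g q, mul_left_cancel₀ hpe ?_⟩
      rw [pow_succ] at hlin
      linarith
    rcases (Nat.prime_iff_prime_int.mp hp).dvd_or_dvd hdg with h | h
    · exact hd h
    · have := Nat.le_of_dvd (Int.natAbs_pos.mpr hgw) (Int.natCast_dvd.mp h)
      omega

/-! ### The digit colouring -/

/-- The last nonzero digit of `a` in base `p`, as a residue; the value at `a = 0` is `0`. -/
def lastDigit (p a : ℕ) : ZMod p := (ordCompl[p] a : ℕ)

theorem lastDigit_ne_zero {p a : ℕ} (hp : p.Prime) (ha : a ≠ 0) : lastDigit p a ≠ 0 := by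
  rw [lastDigit, Ne, ZMod.natCast_eq_zero_iff]
  exact Nat.not_dvd_ordCompl hp ha

theorem eq_pow_mul_of_lastDigit (p a : ℕ) :
    ∃ q : ℤ, (a : ℤ) = p ^ a.factorization p * q ∧ (q : ZMod p) = lastDigit p a := by
  refine ⟨(ordCompl[p] a : ℕ), ?_, by simp only [lastDigit, Int.cast_natCast]⟩
  exact_mod_cast (Nat.ordProj_mul_ordCompl_eq_self a p).symm

/-- If `p ^ e` exactly divides `a`, then `a` is `d p ^ e` modulo `p ^ (e + 1)`, where `d` is the
last nonzero digit of `a`. -/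
theorem pow_succ_dvd_sub_of_lastDigit {p a e : ℕ} (hp : p.Prime) (ha : a ≠ 0) {d : ℤ}
    (hd : lastDigit p a = d) (hdvd : p ^ e ∣ a) (hndvd : ¬ p ^ (e + 1) ∣ a) :
    (p : ℤ) ^ (e + 1) ∣ a - d * p ^ e := by
  have h1 := (hp.pow_dvd_iff_le_factorization ha).mp hdvd
  have h2 := mt (hp.pow_dvd_iff_le_factorization ha).mpr hndvd
  obtain ⟨q, hq, hqd⟩ := eq_pow_mul_of_lastDigit p a
  obtain rfl : a.factorization p = e := by omega
  obtain ⟨c, hc⟩ : (p : ℤ) ∣ q - d := by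
    rw [← ZMod.intCast_zmod_eq_zero_iff_dvd]
    simp [hqd, hd]
  refine ⟨c, ?_⟩
  rw [pow_succ, mul_assoc, ← hc, hq]
  ring

/-- Graph-regularity, applied to colourings with an arbitrary finite set of colours that are
given by a function of the smaller and of the larger endpoint of an edge. -/
theorem GraphRegular.exists_solution {m n : ℕ} {A : Matrix (Fin m) (Fin n) ℤ}
    (hA : GraphRegular A) {κ : Type*} [Finite κ] (f : ℕ → ℕ → κ) :
    ∃ X : Fin n → ℕ, Function.Injective X ∧ (∀ i, X i ≠ 0) ∧
      A.mulVec (fun i => (X i : ℤ)) = 0 ∧ ∃ c, ∀ i j, X i < X j → f (X i) (X j) = c := by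
  obtain ⟨NA, hA⟩ := hA
  let E := Finite.equivFin κ
  obtain ⟨x, hinj, hx, c, hc⟩ := hA (Nat.card κ) (NA (Nat.card κ) + 1) (Nat.lt_succ_self _)
    (SimpleGraph.EdgeLabeling.mk (fun a b _ => E (f (min (a : ℕ) b) (max (a : ℕ) b)))
      fun a b _ => by rw [min_comm, max_comm])
  refine ⟨fun i => x i, fun i j h => hinj (Subtype.ext h), fun i => ?_, hx, E.symm c,
    fun i j hij => ?_⟩
  · have := (Finset.mem_Icc.mp (x i).2).1
    exact Nat.one_le_iff_ne_zero.mp this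
  · have hne : x i ≠ x j := fun h => hij.ne (congrArg Subtype.val h)
    have h := hc i j (by simpa using hne)
    rw [SimpleGraph.EdgeLabeling.get_mk, min_eq_left hij.le, max_eq_right hij.le] at h
    rw [← h, Equiv.symm_apply_apply]

/-- If the entries of a solution have the same last nonzero digit and their `p`-adic valuations
are all equal or pairwise distinct, then the columns of `A` sum to zero, provided that `p` exceeds
the entries of `A` and of the sum of the columns. -/
theorem mulVec_one_eq_zero {m n : ℕ} {A : Matrix (Fin m) (Fin n) ℤ} {p : ℕ} (hp : p.Prime)
    (hA : ∀ k i, (A k i).natAbs < p) (hA1 : ∀ k, (∑ i, A k i).natAbs < p)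
    {X : Fin n → ℕ} (hX0 : ∀ i, X i ≠ 0) (hX : A.mulVec (fun i => (X i : ℤ)) = 0)
    (hdigit : ∀ i j, lastDigit p (X i) = lastDigit p (X j))
    (hval : (∀ i j, (X i).factorization p = (X j).factorization p) ∨
      ∀ i j, i ≠ j → (X i).factorization p ≠ (X j).factorization p) (k : Fin m) :
    ∑ i, A k i = 0 := by
  classical
  have hp' := Nat.prime_iff_prime_int.mp hp
  have hXk : ∑ i, A k i * (X i : ℤ) = 0 := congrFun hX k
  have hsmall : ∀ a : ℤ, a.natAbs < p → (p : ℤ) ∣ a → a = 0 := by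
    intro a ha hdvd
    by_contra h0
    have := Nat.le_of_dvd (Int.natAbs_pos.mpr h0) (Int.natCast_dvd.mp hdvd)
    omega
  choose q hq hqd using fun i => eq_pow_mul_of_lastDigit p (X i)
  have hpq : ∀ i, ¬ (p : ℤ) ∣ q i := by
    intro i h
    rw [← ZMod.intCast_zmod_eq_zero_iff_dvd, hqd] at h
    exact lastDigit_ne_zero hp (hX0 i) h
  have hp0 : ∀ e : ℕ, (p : ℤ) ^ e ≠ 0 := fun e => pow_ne_zero _ hp'.ne_zero
  rcases hval with hval | hval
  · rcases isEmpty_or_nonempty (Fin n) with hn | ⟨⟨i₀⟩⟩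
    · simp
    apply hsmall _ (hA1 k)
    have h1 : ∑ i, A k i * q i = 0 := by
      refine mul_left_cancel₀ (hp0 ((X i₀).factorization p)) ?_
      rw [mul_zero, ← hXk, Finset.mul_sum]
      refine Finset.sum_congr rfl fun i _ => ?_
      rw [hq i, hval i i₀]
      ring
    -- Modulo `p`, the cofactors `q i` are all equal.
    have h2 : (p : ℤ) ∣ (∑ i, A k i) * q i₀ := by
      rw [← ZMod.intCast_zmod_eq_zero_iff_dvd]
      have := congrArg (Int.cast : ℤ → ZMod p) h1
      push_cast at this ⊢
      rw [Finset.sum_mul, ← this]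
      refine Finset.sum_congr rfl fun i _ => ?_
      rw [hqd, hqd, hdigit i i₀]
    exact (hp'.dvd_or_dvd h2).resolve_right (hpq i₀)
  · -- The nonzero term of least valuation cannot be cancelled, so all entries vanish.
    suffices h : ∀ i, A k i = 0 by simp [h]
    by_contra! hne
    obtain ⟨i₀, hi₀, hmin⟩ := Finset.exists_min_image ({i | A k i ≠ 0} : Finset (Fin n))
      (fun i => (X i).factorization p) (by simpa [Finset.Nonempty] using hne)
    simp only [Finset.mem_filter, Finset.mem_univ, true_and] at hi₀ hmin
    have hdvd : (p : ℤ) ^ ((X i₀).factorization p + 1) ∣ A k i₀ * X i₀ := by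
      rw [← Finset.add_sum_erase _ _ (Finset.mem_univ i₀)] at hXk
      rw [eq_neg_of_add_eq_zero_left hXk, dvd_neg]
      refine Finset.dvd_sum fun i hi => ?_
      by_cases h0 : A k i = 0
      · simp [h0]
      have hlt := (hmin i h0).lt_of_ne (hval _ _ (Finset.ne_of_mem_erase hi).symm)
      rw [hq i]
      exact ((pow_dvd_pow _ hlt).mul_right _).mul_left _
    rw [hq i₀, mul_left_comm, pow_succ, mul_dvd_mul_iff_left (hp0 _)] at hdvd
    exact hi₀ (hsmall _ (hA k i₀) ((hp'.dvd_or_dvd hdvd).resolve_right (hpq i₀)))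

/-! ### The weak condition is necessary -/

theorem weak_of_graphRegular {m n : ℕ} (hn : 3 ≤ n) {A : Matrix (Fin m) (Fin n) ℤ}
    (hA : GraphRegular A) : WeakGraphColumnsCondition A := by
  classical
  choose B hB using fun q : (Fin n → Fin n → Prop) × (Fin n → Bool) =>
    exists_prime_bound A q.1 fun i => if q.2 i then 1 else 0
  obtain ⟨b₁, hb₁⟩ := Finite.bddAbove_range B
  obtain ⟨b₂, hb₂⟩ := Finite.bddAbove_range fun q : Fin m × Fin n => (A q.1 q.2).natAbs
  obtain ⟨b₃, hb₃⟩ := Finite.bddAbove_range fun k : Fin m => (∑ i, A k i).natAbs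
  obtain ⟨p, hpb, hp⟩ := Nat.exists_infinite_primes (b₁ + b₂ + b₃ + 1)
  have hp1 : ∀ q, B q < p := fun q => by have := hb₁ ⟨q, rfl⟩; omega
  have hp2 : ∀ k i, (A k i).natAbs < p := fun k i => by
    have h := hb₂ ⟨(k, i), rfl⟩
    simp only at h
    omega
  have hp3 : ∀ k, (∑ i, A k i).natAbs < p := fun k => by
    have h := hb₃ ⟨k, rfl⟩
    simp only at h
    omega
  have : NeZero p := ⟨hp.ne_zero⟩
  obtain ⟨X, hinj, hX0, hX, ⟨d, f, g, b⟩, hc⟩ := hA.exists_solution fun a a' =>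
    (lastDigit p (a' - a), lastDigit p a, lastDigit p a', a.factorization p = a'.factorization p)
  simp only [Prod.mk.injEq, eq_iff_iff] at hc
  -- A third entry, in any position, shows that the digits of two entries agree.
  have hdigit : ∀ i j, lastDigit p (X i) = lastDigit p (X j) := by
    have key : ∀ i j, X i < X j → lastDigit p (X i) = lastDigit p (X j) := by
      intro i j hij
      obtain ⟨k, hki, hkj⟩ : ∃ k, k ≠ i ∧ k ≠ j := by
        have : (({i, j} : Finset (Fin n))ᶜ).Nonempty := by
          rw [← Finset.card_pos, Finset.card_compl, Fintype.card_fin]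
          have := Finset.card_le_two (a := i) (b := j)
          omega
        obtain ⟨k, hk⟩ := this
        exact ⟨k, by simpa using hk⟩
      have h1 := hc i j hij
      rcases (hinj.ne hki).lt_or_gt with h | h
      · rw [(hc k i h).2.2.1, h1.2.2.1]
      · rcases (hinj.ne hkj).lt_or_gt with h' | h'
        · rw [h1.2.1, ← (hc k j h').2.1, (hc i k h).2.2.1, h1.2.2.1]
        · rw [h1.2.1, (hc j k h').2.1]
    intro i j
    rcases lt_trichotomy (X i) (X j) with h | h | h
    · exact key i j h
    · rw [h]
    · exact (key j i h).symm
  have hval : (∀ i j, (X i).factorization p = (X j).factorization p) ∨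
      ∀ i j, i ≠ j → (X i).factorization p ≠ (X j).factorization p := by
    by_cases hb : b
    · refine Or.inl fun i j => ?_
      rcases lt_trichotomy (X i) (X j) with h | h | h
      · exact (hc i j h).2.2.2.mpr hb
      · rw [h]
      · exact ((hc j i h).2.2.2.mpr hb).symm
    · refine Or.inr fun i j hij he => ?_
      rcases (hinj.ne hij).lt_or_gt with h | h
      · exact hb ((hc i j h).2.2.2.mp he)
      · exact hb ((hc j i h).2.2.2.mp he.symm)
  have hone := mulVec_one_eq_zero hp hp2 hp3 hX0 hX hdigit hval
  -- `d` lifted to an integer prime to `p`.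
  obtain ⟨D, hD⟩ := ZMod.intCast_surjective d
  have hpD : ¬ (p : ℤ) ∣ D := by
    rw [← ZMod.intCast_zmod_eq_zero_iff_dvd, hD]
    have h01 : (⟨0, by omega⟩ : Fin n) ≠ ⟨1, by omega⟩ := by simp
    have hne := hinj.ne h01
    rcases hne.lt_or_gt with h | h <;>
      exact (hc _ _ h).1 ▸ lastDigit_ne_zero hp (Nat.sub_ne_zero_of_lt h)
  have hlevel : ∀ e : ℕ, ∃ z : Fin n → ℚ, (A.map (Int.cast : ℤ → ℚ)).mulVec z = 0 ∧
      ∀ i j, (p : ℤ) ^ e ∣ X i - X j →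
        ((p : ℤ) ^ (e + 1) ∣ X i - X j → z i = z j) ∧
        (¬ (p : ℤ) ^ (e + 1) ∣ X i - X j → |z j - z i| = 1) := by
    intro e
    let S : Fin n → Fin n → Prop := fun i j => (p : ℤ) ^ e ∣ X i - X j
    have hsymm : ∀ {i j}, S i j → S j i := fun {i j} h => (dvd_sub_comm).mp h
    have htrans : ∀ {i j k}, S i j → S j k → S i k := fun {i j k} h h' => by
      have := dvd_add h h'
      rwa [sub_add_sub_cancel] at this
    -- The least element of the residue class of `i`.
    have hmin : ∀ i, ∃ a, S i a ∧ ∀ k, S i k → X a ≤ X k := by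
      intro i
      obtain ⟨a, ha, h⟩ := Finset.exists_min_image ({k | S i k} : Finset (Fin n)) X
        ⟨i, by simp [S]⟩
      simp only [Finset.mem_filter, Finset.mem_univ, true_and] at ha h
      exact ⟨a, ha, h⟩
    choose ρ hρ hρmin using hmin
    have hρS : ∀ i j, S i j → ρ i = ρ j := fun i j h => hinj <| le_antisymm
      (hρmin i _ (htrans h (hρ j))) (hρmin j _ (htrans (hsymm h) (hρ i)))
    let w : Fin n → Bool := fun i => ! decide ((p : ℤ) ^ (e + 1) ∣ X i - X (ρ i))
    have hw : ∀ i, (p : ℤ) ^ (e + 1) ∣ X i - X (ρ i) - D * p ^ e * (if w i then 1 else 0) := by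
      intro i
      by_cases h : (p : ℤ) ^ (e + 1) ∣ X i - X (ρ i)
      · simp [w, h]
      · have hlt : X (ρ i) < X i := by
          refine (hρmin i i (by simp [S])).lt_of_ne fun heq => h ?_
          simp [heq]
        have hcast : ((X i - X (ρ i) : ℕ) : ℤ) = X i - X (ρ i) := by
          push_cast [hlt.le]
          ring
        have h' := pow_succ_dvd_sub_of_lastDigit (e := e) hp (Nat.sub_ne_zero_of_lt hlt)
          ((hc _ _ hlt).1.trans hD.symm)
          (by have := hρ i; simp only [S, ← hcast] at this; exact_mod_cast this)
          (by rw [← hcast] at h; exact_mod_cast h)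
        rw [hcast] at h'
        simpa [w, h] using h'
    obtain ⟨z, hz, hzw⟩ := hB (S, w) p hp (hp1 _) e D hpD (fun i => X i) (fun i => X (ρ i)) hX
      (fun i j h => by rw [hρS i j h]) hw
    refine ⟨z, hz, fun i j hij => ?_⟩
    have hzij := hzw i j hij
    have hdiff : (p : ℤ) ^ (e + 1) ∣
        X i - X j - D * p ^ e * ((if w i then 1 else 0) - if w j then 1 else 0) := by
      have := dvd_sub (hw i) (hw j)
      rw [hρS i j hij] at this
      exact (congrArg _ (by ring)).mp this
    have hndvd : ¬ (p : ℤ) ^ (e + 1) ∣ D * p ^ e := by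
      rw [pow_succ, mul_comm D, mul_dvd_mul_iff_left (pow_ne_zero _ (by exact_mod_cast hp.ne_zero))]
      exact hpD
    cases hwi : w i <;> cases hwj : w j <;> simp [hwi, hwj] at hzij hdiff
    · exact ⟨fun _ => by linarith, fun h => absurd hdiff h⟩
    · refine ⟨fun h => absurd ((dvd_add_right h).mp hdiff) hndvd, fun _ => ?_⟩
      rw [show z j - z i = 1 by linarith, abs_one]
    · refine ⟨fun h => absurd ((dvd_sub_right h).mp hdiff) hndvd, fun _ => ?_⟩
      rw [show z j - z i = -1 by linarith, abs_neg, abs_one]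
    · exact ⟨fun _ => by linarith, fun h => absurd hdiff h⟩
  choose z hz hzX using hlevel
  obtain ⟨T, hT⟩ := Finite.bddAbove_range X
  have hXT : ∀ i, X i < p ^ T := fun i => (hT ⟨i, rfl⟩).trans_lt (Nat.lt_pow_self hp.one_lt)
  have hmono : ∀ {s t : ℕ} {i j}, s ≤ t → (p : ℤ) ^ t ∣ X i - X j → (p : ℤ) ^ s ∣ X i - X j :=
    fun h => (pow_dvd_pow _ h).trans
  refine ⟨T, Fin.cons (fun _ => 1) fun s => z s, fun t =>
    { Adj := fun i j => i ≠ j ∧ (p : ℤ) ^ (t : ℕ) ∣ X i - X j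
      symm := ⟨fun i j h => ⟨h.1.symm, dvd_sub_comm.mp h.2⟩⟩
      loopless := ⟨fun i h => h.1 rfl⟩ }, ⟨fun t => ?_, ?_, ?_, rfl⟩, ?_, ?_⟩
  · cases t using Fin.cases with
    | zero =>
      funext k
      simpa [Matrix.mulVec, dotProduct] using congrArg (Int.cast : ℤ → ℚ) (hone k)
    | succ s => exact hz s
  · intro s t hst i j h
    exact ⟨h.1, hmono hst h.2⟩
  · ext i j
    simp only [Fin.val_last, SimpleGraph.bot_adj, iff_false, not_and]
    intro hij hdvd
    refine hij (hinj ?_)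
    have h := Int.eq_zero_of_abs_lt_dvd hdvd (by
      have hi := hXT i
      have hj := hXT j
      zify at hi hj
      rw [abs_lt]
      constructor <;> linarith [Int.natCast_nonneg (X i), Int.natCast_nonneg (X j)])
    omega
  · intro t i j h s hst
    cases s using Fin.cases with
    | zero => rfl
    | succ s =>
      have hst : (s : ℕ) + 1 ≤ t := by simpa [Fin.le_def] using hst
      exact (hzX s i j (hmono (by omega) h.2)).1 (hmono hst h.2)
  · intro t i j hij hnadj
    have hnd : ¬ (p : ℤ) ^ (t : ℕ) ∣ X i - X j := fun h => hnadj ⟨hij, h⟩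
    -- The values at `i` and `j` differ by one at the first power of `p` that separates them.
    have hex : ∃ e : ℕ, ¬ (p : ℤ) ^ e ∣ X i - X j := ⟨t, hnd⟩
    obtain ⟨e, he⟩ : ∃ e, Nat.find hex = e + 1 := by
      refine Nat.exists_eq_succ_of_ne_zero fun h => ?_
      have := Nat.find_spec hex
      simp [h] at this
    have hspec := Nat.find_spec hex
    have hle := Nat.find_min' hex hnd
    have hlt := Nat.find_min hex (m := e) (by omega)
    rw [he] at hspec hle
    push Not at hlt
    refine ⟨Fin.succ ⟨e, by omega⟩, by simpa [Fin.le_def] using hle, ?_⟩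
    rw [Fin.cons_succ]
    exact (hzX e i j hlt).2 hspec

end GraphRado

theorem theorem2p6 {m n : ℕ} (hn : 3 ≤ n) (A : Matrix (Fin m) (Fin n) ℤ) :
    (GraphRado.GraphRegular A → GraphRado.WeakGraphColumnsCondition A) ∧
    (GraphRado.StrongGraphColumnsCondition A → GraphRado.GraphRegular A) :=
  ⟨GraphRado.weak_of_graphRegular hn, GraphRado.graphRegular_of_strong (by omega)⟩
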